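/- Let $g\ge 2$ and $n\ge 1$ be integers and let $L\in\mathbb{N}$ satisfy $L \ge 2\lceil \log_g n\rceil$. For a $g$-tuple $A=(A_1,\dots,A_g)\in M_n(\mathbb{C})^g$ of complex $n\times n$ matrices consider the linear map \[ \Gamma_L : M_n(\mathbb{C})\to (\mathbb{C}^g)^{\otimes L},\qquad \Gamma_L(X)=\sum_{i_1,\dots,i_L=1}^{g}\operatorname{tr}\left[X A_{i_1}\cdots A_{i_L}\right]\,|i_1\dots i_L\rangle , \] where $|i_1\dots i_L\rangle=e_{i_1}\otimes\cdots\otimes e_{i_L}$ is the standard product basis of $(\mathbb{C}^g)^{\otimes L}$ (for $L=0$ the empty product of matrices is the identity). Then $\Gamma_L$ is injective for almost every $A\in M_n(\mathbb{C})^g$ with respect to Lebesgue measure on $M_n(\mathbb{C})^g\cong\mathbb{C}^{gn^2}$. -/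

import Mathlib

open scoped TensorProduct

noncomputable section

/-- The product basis vector `|i_1 … i_L⟩ = e_{i_1} ⊗ ⋯ ⊗ e_{i_L}` of `(ℂ^g)^{⊗ L}`. -/
def ketMPS {g L : ℕ} (i : Fin L → Fin g) : ⨂[ℂ] _ : Fin L, EuclideanSpace ℂ (Fin g) :=
  PiTensorProduct.tprod ℂ fun k => EuclideanSpace.single (i k) (1 : ℂ)

/-- The word `A_{i_1} A_{i_2} ⋯ A_{i_L}` (in this order; the identity matrix when `L = 0`). -/
def wordMPS {g n L : ℕ} (A : Fin g → Matrix (Fin n) (Fin n) ℂ) (i : Fin L → Fin g) :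
    Matrix (Fin n) (Fin n) ℂ :=
  (List.ofFn fun k => A (i k)).prod

/-- The linear map `Γ_L : M_n(ℂ) → (ℂ^g)^{⊗ L}`,
`X ↦ ∑_{i_1, …, i_L} tr[X A_{i_1} ⋯ A_{i_L}] |i_1 … i_L⟩`. -/
def mapMPS {g n : ℕ} (L : ℕ) (A : Fin g → Matrix (Fin n) (Fin n) ℂ) :
    Matrix (Fin n) (Fin n) ℂ →ₗ[ℂ] ⨂[ℂ] _ : Fin L, EuclideanSpace ℂ (Fin g) where
  toFun X := ∑ i : Fin L → Fin g, (X * wordMPS A i).trace • ketMPS i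
  map_add' X Y := by
    simp only [add_mul, Matrix.trace_add, add_smul, Finset.sum_add_distrib]
  map_smul' c X := by
    simp only [Matrix.smul_mul, Matrix.trace_smul, smul_assoc, Finset.smul_sum, RingHom.id_apply]

end

/-!
Let `k = ⌈log_g n⌉`, so that `n ≤ g ^ k` and `2 * k ≤ L`. A left inverse `l` of the map `Γ_L` at one
tuple at which it is injective turns injectivity into the nonvanishing of the polynomial
`A ↦ det (l ∘ Γ_L(A))`, and a nonzero real-analytic function vanishes only on a null set
(`ae_ne_zero_of_analyticOnNhd`). So a single good tuple is enough. Since the product basis is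
linearly independent, good means: a matrix `X` with `tr (X A_w) = 0` for all words `w` of length `L`
is zero.

The good tuple consists of weighted transition matrices of an automaton with `n` states over the
alphabet `Fin g`. Letter `i` sends state `x` to `τ i x`, and two properties are needed
(`exists_definite_automaton`):

* every word of length at least `k` is a reset: it sends all states to the same state;
* for a suitable labelling `j` of the states by letters, `x ↦ τ (j x) x` is a permutation `ν`.

Let `A_i` send `e_x` to `c • e_{τ i x}`, where `c = 1` if `i = j x` and `c = ε` otherwise. By the
reset property a word of length `m ≥ k` acts as a rank-one matrix `e_p ⊗ φ_w`, and `p` can be any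
state, because the word that follows the `ν`-orbit of `ν⁻ᵐ p` leads to `p`. If `w_x` is the word of
length `k` that follows the `ν`-orbit of `x`, then `φ_{w_x} x = 1`, while `φ_{w_x} y = O(ε)` for
`y ≠ x`, as `w_x = w_y` would reset `x` and `y` to the distinct states `ν^k x` and `ν^k y`. Hence for
small `ε ≠ 0` the `φ_{w_x}` form a basis, by diagonal dominance. All weights are nonzero, so
composing a word of length `L - k ≥ k` with some `w_x` yields nonzero multiples of all
`e_p ⊗ φ_{w_x}`, and these span the matrices (`eq_zero_of_trace_mul_transitionMatrix`).

For the automaton, sort `{0, …, n - 1}` stably by residue modulo `g`. The sorting permutation `μ`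
stretches distances at least by the factor `g` between positions carrying the same residue, so `k`
consecutive residues along a `μ`-orbit determine its starting point, because `n ≤ g ^ k`. Put
`ν = μ⁻¹` and `j y = y % g`; the residue sequence of `x` records the letters that led to `x` along
`ν`. Letter `i` acts by first retracting onto the states with label `i`, in a way that does not
shorten common prefixes of residue sequences, and then applying `ν`. Every letter thus lengthens
common prefixes by at least one, and `k` letters merge all states.
-/

open MeasureTheory

/-! ### An expanding permutation -/

/-- The stable sort of `0, …, n - 1` by residue modulo `g` is expanding on each residue class:
between two positions with equal residue the sorted values are congruent and strictly increasing. -/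
theorem exists_perm_expanding (g n : ℕ) :
    ∃ μ : Equiv.Perm (Fin n), ∀ x y : Fin n, x ≤ y → (μ x : ℕ) % g = (μ y : ℕ) % g →
      (μ x : ℕ) + g * (y - x) ≤ μ y := by
  let f : Fin n → ℕ := fun y => y % g
  refine ⟨Tuple.sort f, ?_⟩
  obtain ⟨hmono, hstable⟩ := Tuple.eq_sort_iff.1 (rfl : Tuple.sort f = Tuple.sort f)
  generalize Tuple.sort f = μ at hmono hstable
  suffices H : ∀ (d : ℕ) (x y : Fin n), (y : ℕ) = x + d → f (μ x) = f (μ y) →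
      (μ x : ℕ) + g * d ≤ μ y by
    intro x y hxy h
    exact H (y - x) x y (by have : (x : ℕ) ≤ y := hxy; omega) h
  intro d
  induction d with
  | zero =>
    intro x y h _
    have : x = y := Fin.ext (by omega)
    simp [this]
  | succ d ih =>
    intro x y h hf
    have hy := y.isLt
    let z : Fin n := ⟨x + d, by omega⟩
    have hxz : x ≤ z := Fin.le_def.2 (by simp [z])
    have hzy : z < y := Fin.lt_def.2 (by simp [z]; omega)
    have h1 : f (μ x) ≤ f (μ z) := hmono hxz
    have h2 : f (μ z) ≤ f (μ y) := hmono hzy.le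
    have h3 : f (μ z) = f (μ y) := by omega
    have h4 : (μ z : ℕ) < μ y := hstable z y hzy h3
    have h5 := ih x z rfl (by omega)
    -- `μ z < μ y` are congruent modulo `g`, so they differ by at least `g`.
    have h6 : (μ z : ℕ) + g ≤ μ y := by
      have h7 : g ∣ (μ y : ℕ) - μ z := (Nat.modEq_iff_dvd' h4.le).1 h3
      have h8 := Nat.le_of_dvd (by omega) h7
      omega
    rw [Nat.mul_succ]
    omega

/-- Points with the same first `k` residues along their orbits under an expanding permutation
coincide: otherwise their distance would grow to at least `g ^ k ≥ n`. -/
theorem eq_of_itinerary_eq {g n k : ℕ} (hn : n ≤ g ^ k) (μ : Equiv.Perm (Fin n))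
    (hμ : ∀ x y : Fin n, x ≤ y → (μ x : ℕ) % g = (μ y : ℕ) % g →
      (μ x : ℕ) + g * (y - x) ≤ μ y)
    (x y : Fin n) (h : ∀ t < k, (μ ((μ ^ t) x) : ℕ) % g = (μ ((μ ^ t) y) : ℕ) % g) : x = y := by
  wlog hxy : x < y generalizing x y
  · rcases (not_lt.1 hxy).eq_or_lt with h' | h'
    · exact h'.symm
    · exact (this y x (fun t ht => (h t ht).symm) h').symm
  exfalso
  have H : ∀ s ≤ k, ((μ ^ s) x : ℕ) + g ^ s * (y - x) ≤ (μ ^ s) y := by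
    intro s
    induction s with
    | zero =>
      have : (x : ℕ) < y := hxy
      intro _
      simp only [pow_zero, Equiv.Perm.coe_one, id_eq, one_mul]
      omega
    | succ s ih =>
      intro hs
      have h1 := ih (by omega)
      have h2 := hμ ((μ ^ s) x) ((μ ^ s) y) (Fin.le_def.2 (by omega)) (h s (by omega))
      rw [pow_succ', Equiv.Perm.mul_apply, Equiv.Perm.mul_apply, pow_succ', mul_assoc]
      have h3 : g * (g ^ s * ((y : ℕ) - x)) ≤ g * (((μ ^ s) y : ℕ) - (μ ^ s) x) :=
        Nat.mul_le_mul_left g (by omega)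
      omega
  have h1 := H k le_rfl
  have h2 := ((μ ^ k) y).isLt
  have h3 : g ^ k * 1 ≤ g ^ k * ((y : ℕ) - x) :=
    Nat.mul_le_mul_left _ (by have : (x : ℕ) < y := hxy; omega)
  omega

/-! ### A definite automaton containing a permutation -/

/-- If the points of a finite set are identified with infinite words, every nonempty subset is the
image of a retraction under which common prefixes do not get shorter. This is the existence of
`1`-Lipschitz retractions onto closed sets in the ultrametric space of infinite words. -/
theorem exists_prefix_preserving_retraction {S α : Type*} [Finite S] (W : S → ℕ → α)
    (hW : Function.Injective W) {X : Set S} (hX : X.Nonempty) :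
    ∃ ρ : S → S, (∀ x, ρ x ∈ X) ∧ (∀ x ∈ X, ρ x = x) ∧
      ∀ s x y, (∀ t < s, W x t = W y t) → ∀ t < s, W (ρ x) t = W (ρ y) t := by
  classical
  let _ : TopologicalSpace α := ⊥
  have _ : DiscreteTopology α := ⟨rfl⟩
  let _ : MetricSpace (ℕ → α) := PiNat.metricSpace
  have hfin : (W '' X).Finite := Set.toFinite _
  obtain ⟨f, hf1, hf2, hf3⟩ :=
    PiNat.exists_lipschitz_retraction_of_isClosed hfin.isClosed (hX.image W)
  have hmem : ∀ x, ∃ y ∈ X, W y = f (W x) := fun x => by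
    have : f (W x) ∈ W '' X := hf2 ▸ Set.mem_range_self _
    exact this
  choose ρ hρX hρ using hmem
  refine ⟨ρ, hρX, fun x hx => hW ?_, fun s x y h t ht => ?_⟩
  · rw [hρ, hf1 _ (Set.mem_image_of_mem W hx)]
  · have h1 : W x ∈ PiNat.cylinder (W y) s := fun t ht => h t ht
    have h2 : f (W x) ∈ PiNat.cylinder (f (W y)) s := by
      rw [PiNat.mem_cylinder_iff_dist_le] at h1 ⊢
      exact (hf3.dist_le_mul _ _).trans (by simpa using h1)
    rw [hρ, hρ]
    exact h2 t ht

/-- There is an automaton with `n ≤ g ^ k` states and `g` letters in which every word of length at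
least `k` is a reset, and in which letting each state `x` read its own letter `j x` permutes the
states. The last letter of a word acts first. -/
theorem exists_definite_automaton {g n k : ℕ} (hg : 0 < g) (hn : 0 < n) (hk : n ≤ g ^ k) :
    ∃ (ν : Equiv.Perm (Fin n)) (j : Fin n → Fin g) (τ : Fin g → Fin n → Fin n),
      (∀ x, τ (j x) x = ν x) ∧
      ∀ w : List (Fin g), k ≤ w.length → ∀ x y, w.foldr τ x = w.foldr τ y := by
  obtain ⟨μ, hμ⟩ := exists_perm_expanding g n
  let j : Fin n → Fin g := fun y => ⟨y % g, Nat.mod_lt _ hg⟩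
  -- `W x` lists the letters that led to `x` along `μ⁻¹`, the most recent one first.
  let W : Fin n → ℕ → Fin g := fun x t => j (μ ((μ ^ t) x))
  have hW : ∀ x y, (∀ t < k, W x t = W y t) → x = y := fun x y h =>
    eq_of_itinerary_eq hk μ hμ x y fun t ht => congrArg Fin.val (h t ht)
  have hcons : ∀ y s, W (μ⁻¹ y) (s + 1) = W y s := by
    intro y s
    simp [W, pow_succ]
  have hτ : ∀ i, ∃ τ : Fin n → Fin n, (∀ x, j x = i → τ x = μ⁻¹ x) ∧
      ∀ s x y, (∀ t < s, W x t = W y t) → ∀ t < s + 1, W (τ x) t = W (τ y) t := by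
    intro i
    rcases ({x | j x = i} : Set (Fin n)).eq_empty_or_nonempty with hX | hX
    · -- A letter that labels no state (possible when `n < g`) may act as a constant.
      refine ⟨fun _ => ⟨0, hn⟩, fun x hx => ?_, fun _ _ _ _ _ _ => rfl⟩
      have : x ∈ ({x | j x = i} : Set (Fin n)) := hx
      simp [hX] at this
    · obtain ⟨ρ, h1, h2, h3⟩ := exists_prefix_preserving_retraction W
        (fun x y h => hW x y fun t _ => congrFun h t) hX
      refine ⟨fun x => μ⁻¹ (ρ x), fun x hx => congrArg _ (h2 x hx), fun s x y h t ht => ?_⟩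
      cases t with
      | zero =>
        have hx : j (ρ x) = i := h1 x
        have hy : j (ρ y) = i := h1 y
        simp [W, hx, hy]
      | succ t =>
        rw [hcons, hcons]
        exact h3 s x y h t (by omega)
  choose τ h1 h2 using hτ
  refine ⟨μ⁻¹, j, τ, fun x => h1 _ x rfl, fun w hw x y => ?_⟩
  have H : ∀ w : List (Fin g), ∀ t < w.length, W (w.foldr τ x) t = W (w.foldr τ y) t := by
    intro w
    induction w with
    | nil => intro t ht; simp at ht
    | cons i w ih => exact h2 i _ _ _ ih
  exact hW _ _ fun t ht => H w t (by omega)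

/-! ### Weighted transition matrices -/

section Weighted

variable {S Γ : Type*}

/-- The word of length `m` whose letters are the labels `j` along the `ν`-orbit of `x`. Words act
from the right, so the label of `x` itself is the last letter. -/
def pathWord (ν : Equiv.Perm S) (j : S → Γ) : ℕ → S → List Γ
  | 0, _ => []
  | m + 1, x => j ((ν ^ m) x) :: pathWord ν j m x

theorem length_pathWord (ν : Equiv.Perm S) (j : S → Γ) (m : ℕ) (x : S) :
    (pathWord ν j m x).length = m := by
  induction m with
  | zero => rfl
  | succ m ih => simp [pathWord, ih]

theorem foldr_pathWord {ν : Equiv.Perm S} {j : S → Γ} {τ : Γ → S → S}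
    (h : ∀ x, τ (j x) x = ν x) (m : ℕ) (x : S) :
    (pathWord ν j m x).foldr τ x = (ν ^ m) x := by
  induction m with
  | zero => rfl
  | succ m ih => rw [pathWord, List.foldr_cons, ih, h, pow_succ', Equiv.Perm.mul_apply]

variable [DecidableEq Γ]

/-- The weight of reading the word `w` from the state `x`: the product over the letters of `w`, from
the right, of `1` if the letter is the label `j` of the current state and of `ε` otherwise. -/
def wordWeight (τ : Γ → S → S) (j : S → Γ) (ε : ℂ) : List Γ → S → ℂ
  | [], _ => 1
  | i :: w, x => (if i = j (w.foldr τ x) then 1 else ε) * wordWeight τ j ε w x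

theorem wordWeight_append (τ : Γ → S → S) (j : S → Γ) (ε : ℂ) (v w : List Γ) (x : S) :
    wordWeight τ j ε (v ++ w) x =
      wordWeight τ j ε v (w.foldr τ x) * wordWeight τ j ε w x := by
  induction v with
  | nil => simp [wordWeight]
  | cons i v ih => simp [wordWeight, ih, mul_assoc]

theorem wordWeight_ne_zero (τ : Γ → S → S) (j : S → Γ) {ε : ℂ} (hε : ε ≠ 0) (w : List Γ) (x : S) :
    wordWeight τ j ε w x ≠ 0 := by
  induction w with
  | nil => simp [wordWeight]
  | cons i w ih =>
    refine mul_ne_zero ?_ ih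
    split_ifs
    exacts [one_ne_zero, hε]

theorem wordWeight_pathWord {ν : Equiv.Perm S} {j : S → Γ} {τ : Γ → S → S}
    (h : ∀ x, τ (j x) x = ν x) (ε : ℂ) (m : ℕ) (x : S) :
    wordWeight τ j ε (pathWord ν j m x) x = 1 := by
  induction m with
  | zero => rfl
  | succ m ih => simp [pathWord, wordWeight, ih, foldr_pathWord h]

theorem norm_wordWeight_le_one (τ : Γ → S → S) (j : S → Γ) {ε : ℂ} (hε : ‖ε‖ ≤ 1) (w : List Γ)
    (x : S) : ‖wordWeight τ j ε w x‖ ≤ 1 := by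
  induction w with
  | nil => simp [wordWeight]
  | cons i w ih =>
    rw [wordWeight, norm_mul]
    refine mul_le_one₀ ?_ (norm_nonneg _) ih
    split_ifs
    exacts [norm_one.le, hε]

/-- A word that leaves the `ν`-orbit of `x` at some letter contains a factor `ε`. -/
theorem norm_wordWeight_le {ν : Equiv.Perm S} {j : S → Γ} {τ : Γ → S → S}
    (h : ∀ x, τ (j x) x = ν x) {ε : ℂ} (hε : ‖ε‖ ≤ 1) (w : List Γ) (x : S)
    (hw : w ≠ pathWord ν j w.length x) : ‖wordWeight τ j ε w x‖ ≤ ‖ε‖ := by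
  induction w with
  | nil => exact absurd rfl hw
  | cons i w ih =>
    rw [wordWeight, norm_mul]
    by_cases hwx : w = pathWord ν j w.length x
    · have hi : i ≠ j (w.foldr τ x) := by
        rintro rfl
        refine hw ?_
        rw [List.length_cons, pathWord, ← hwx, ← foldr_pathWord h, ← hwx]
      rw [if_neg hi]
      exact mul_le_of_le_one_right (norm_nonneg _) (norm_wordWeight_le_one τ j hε w x)
    · refine (mul_le_of_le_one_left (norm_nonneg _) ?_).trans (ih hwx)
      split_ifs
      exacts [norm_one.le, hε]

variable [DecidableEq S]

/-- The matrix of the letter `i`: it maps the basis vector of a state `x` to that of `τ i x`,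
multiplied by `1` if `i` is the label of `x` and by `ε` otherwise. -/
def transitionMatrix (τ : Γ → S → S) (j : S → Γ) (ε : ℂ) (i : Γ) : Matrix S S ℂ :=
  Matrix.of fun p x => if p = τ i x then (if i = j x then 1 else ε) else 0

variable [Fintype S]

theorem prod_transitionMatrix_apply (τ : Γ → S → S) (j : S → Γ) (ε : ℂ) (w : List Γ) (p x : S) :
    (w.map (transitionMatrix τ j ε)).prod p x =
      if p = w.foldr τ x then wordWeight τ j ε w x else 0 := by
  induction w generalizing p with
  | nil => exact Matrix.one_apply
  | cons i w ih =>
    simp [Matrix.mul_apply, ih, transitionMatrix, wordWeight]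

/-- The words of length `L ≥ 2 * k` in the transition matrices of an automaton with the reset
property span all matrices, expressed through the trace form. -/
theorem eq_zero_of_trace_mul_transitionMatrix {ν : Equiv.Perm S} {j : S → Γ} {τ : Γ → S → S}
    {k : ℕ} (h : ∀ x, τ (j x) x = ν x)
    (hτ : ∀ w : List Γ, k ≤ w.length → ∀ x y, w.foldr τ x = w.foldr τ y)
    {L : ℕ} (hL : 2 * k ≤ L) {ε : ℂ} (hε0 : ε ≠ 0) (hε : ‖ε‖ * (Fintype.card S + 1) ≤ 1)
    (X : Matrix S S ℂ)
    (hX : ∀ w : List Γ, w.length = L →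
      (X * (w.map (transitionMatrix τ j ε)).prod).trace = 0) : X = 0 := by
  let Φ : Matrix S S ℂ := Matrix.of fun x y => wordWeight τ j ε (pathWord ν j k x) y
  have hε1 : ‖ε‖ ≤ 1 :=
    (le_mul_of_one_le_right (norm_nonneg ε) (by simp)).trans hε
  have hne : ∀ x y, x ≠ y → pathWord ν j k x ≠ pathWord ν j k y := by
    intro x y hxy he
    have h1 := hτ (pathWord ν j k x) (length_pathWord ν j k x).ge x y
    rw [foldr_pathWord h, he, foldr_pathWord h] at h1
    exact hxy ((ν ^ k).injective h1)
  -- The bound on `ε` makes `Φ` strictly diagonally dominant, with diagonal entries `1`.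
  have hΦ : Φ.det ≠ 0 := by
    refine det_ne_zero_of_sum_row_lt_diag fun x => ?_
    calc ∑ y ∈ Finset.univ.erase x, ‖Φ x y‖ ≤ ∑ y ∈ Finset.univ.erase x, ‖ε‖ := by
          refine Finset.sum_le_sum fun y hy => norm_wordWeight_le h hε1 _ _ ?_
          rw [length_pathWord]
          exact hne x y (Finset.ne_of_mem_erase hy).symm
      _ ≤ ‖ε‖ * Fintype.card S := by
          rw [Finset.sum_const, nsmul_eq_mul, mul_comm]
          gcongr
          exact Finset.card_le_univ _
      _ < 1 := by
          have := norm_pos_iff.2 hε0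
          linarith
      _ = ‖Φ x x‖ := by simp [Φ, wordWeight_pathWord h]
  have hcol : ∀ p, Φ.mulVec (fun y => X y p) = 0 := by
    intro p
    funext x
    -- `v` resets to `p`, so the matrix of `v ++ pathWord ν j k x` is a nonzero multiple of the
    -- matrix with row `p` equal to row `x` of `Φ` and all other rows zero.
    let v := pathWord ν j (L - k) ((ν ^ (L - k))⁻¹ p)
    have hv : ∀ y, v.foldr τ y = p := by
      intro y
      rw [hτ v (by simp only [v, length_pathWord]; omega) y ((ν ^ (L - k))⁻¹ p),
        foldr_pathWord h]
      simp
    have h1 := hX (v ++ pathWord ν j k x) (by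
      simp only [List.length_append, v, length_pathWord]; omega)
    have h2 : ∀ y, (pathWord ν j k x).foldr τ y = (ν ^ k) x := fun y => by
      rw [hτ _ (length_pathWord ν j k x).ge y x, foldr_pathWord h]
    have h3 : wordWeight τ j ε v ((ν ^ k) x) * Φ.mulVec (fun y => X y p) x = 0 := by
      rw [← h1]
      simp only [Matrix.trace, Matrix.diag, Matrix.mul_apply, prod_transitionMatrix_apply,
        List.foldr_append, hv, wordWeight_append, h2, Matrix.mulVec, dotProduct, Φ, Matrix.of_apply,
        Finset.mul_sum]
      refine Finset.sum_congr rfl fun y _ => ?_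
      simp
      ring
    exact (mul_eq_zero.1 h3).resolve_left (wordWeight_ne_zero τ j hε0 _ _)
  ext y p
  exact congrFun (Matrix.eq_zero_of_mulVec_eq_zero hΦ (hcol p)) y

end Weighted

/-! ### Lebesgue null sets -/

/-- A real-analytic function that is not identically zero is nonzero almost everywhere. On each line
through a point `a` with `f a ≠ 0` the zeros form a null set; by Fubini almost every rescaling about
`a` of the zero set is null, and rescaling by `r ≠ 0` preserves null sets. -/
theorem ae_ne_zero_of_analyticOnNhd {E F : Type*} [NormedAddCommGroup E] [NormedSpace ℝ E]
    [FiniteDimensional ℝ E] [MeasurableSpace E] [BorelSpace E] (μ : Measure E) [μ.IsAddHaarMeasure]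
    [NormedAddCommGroup F] [NormedSpace ℝ F] {f : E → F} (hf : AnalyticOnNhd ℝ f Set.univ)
    {a : E} (ha : f a ≠ 0) : ∀ᵐ x ∂μ, f x ≠ 0 := by
  have hcont : Continuous f := continuousOn_univ.1 hf.continuousOn
  let Z : Set (E × ℝ) := {q | f (a + q.2 • q.1) = 0}
  have hZ : MeasurableSet Z :=
    (isClosed_singleton.preimage (t := {0}) (by fun_prop :
      Continuous fun q : E × ℝ => f (a + q.2 • q.1))).measurableSet
  have hline : ∀ x : E, volume (Prod.mk x ⁻¹' Z) = 0 := by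
    intro x
    have han : AnalyticOnNhd ℝ (fun t : ℝ => f (a + t • x)) Set.univ := fun t _ =>
      (hf _ (Set.mem_univ _)).comp (f := fun t : ℝ => a + t • x) (by fun_prop)
    have h1 := han.preimage_zero_mem_codiscrete (x := 0) (by simpa using ha)
    have h2 := ae_restrict_le_codiscreteWithin (μ := volume) MeasurableSet.univ h1
    rw [Measure.restrict_univ] at h2
    convert mem_ae_iff.1 h2 using 2
    ext t
    simp [Z]
  have hprod : (volume.prod μ) (Prod.swap ⁻¹' Z) = 0 := by
    rw [Measure.measurePreserving_swap.measure_preimage hZ.nullMeasurableSet,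
      Measure.measure_prod_null hZ]
    exact Filter.Eventually.of_forall hline
  -- By Fubini the sections at a fixed dilation factor are null for almost every factor.
  have hslice := Measure.measure_ae_null_of_prod_null hprod
  obtain ⟨r, hr, hr0⟩ : ∃ r : ℝ, μ {x | f (a + r • x) = 0} = 0 ∧ r ≠ 0 :=
    (hslice.and (Measure.ae_ne volume 0)).exists
  rw [ae_iff]
  simp only [not_not]
  have h1 : {x | f (a + r • x) = 0} = (r • ·) ⁻¹' ((a + ·) ⁻¹' {x | f x = 0}) := rfl
  rw [h1, Measure.addHaar_preimage_smul μ hr0, measure_preimage_add] at hr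
  refine (mul_eq_zero.1 hr).resolve_left ?_
  simp [hr0]

/-- The case of a constant family of the instance on products, for iterated function types, where
instance search fails to unify the family. -/
theorem isAddHaarMeasure_volume_pi (ι G : Type*) [Fintype ι] [AddGroup G] [TopologicalSpace G]
    [MeasureSpace G] [MeasurableAdd G] [SigmaFinite (volume : Measure G)]
    [(volume : Measure G).IsAddHaarMeasure] : (volume : Measure (ι → G)).IsAddHaarMeasure :=
  inferInstance

/-- The case of a constant family of the instance on products, for iterated function types. -/
theorem sigmaFinite_volume_pi (ι G : Type*) [Fintype ι] [MeasureSpace G]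
    [SigmaFinite (volume : Measure G)] : SigmaFinite (volume : Measure (ι → G)) :=
  inferInstance

/-! ### The map `Γ_L` -/

theorem linearIndependent_ketMPS (g L : ℕ) :
    LinearIndependent ℂ (ketMPS : (Fin L → Fin g) → ⨂[ℂ] _ : Fin L, EuclideanSpace ℂ (Fin g)) := by
  have h := (Basis.piTensorProduct fun _ : Fin L =>
    (EuclideanSpace.basisFun (Fin g) ℂ).toBasis).linearIndependent
  have hket : (Basis.piTensorProduct fun _ : Fin L =>
      (EuclideanSpace.basisFun (Fin g) ℂ).toBasis) = (ketMPS : (Fin L → Fin g) → _) := by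
    funext i
    simp [ketMPS, Basis.piTensorProduct_apply]
  exact hket ▸ h

theorem injective_mapMPS_of_trace {g n L : ℕ} {A : Fin g → Matrix (Fin n) (Fin n) ℂ}
    (h : ∀ X, (∀ w : List (Fin g), w.length = L → (X * (w.map A).prod).trace = 0) → X = 0) :
    Function.Injective (mapMPS L A) := by
  refine (injective_iff_map_eq_zero _).2 fun X hX => h X ?_
  rintro w rfl
  have h1 := Fintype.linearIndependent_iff.1 (linearIndependent_ketMPS g w.length) _ hX w.get
  rw [wordMPS, List.ofFn_comp'] at h1
  simpa using h1

theorem analyticAt_wordMPS {g n L : ℕ} (i : Fin L → Fin g) (p q : Fin n)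
    (a : Fin g → Fin n → Fin n → ℂ) :
    AnalyticAt ℂ (fun a : Fin g → Fin n → Fin n → ℂ =>
      wordMPS (fun i => Matrix.of (a i)) i p q) a := by
  induction L generalizing p with
  | zero => simp [wordMPS]; fun_prop
  | succ L ih =>
    simp only [wordMPS, List.ofFn_succ, List.prod_cons, Matrix.mul_apply, Matrix.of_apply]
    refine Finset.analyticAt_fun_sum _ fun m _ => ?_
    refine AnalyticAt.mul ?_ (ih _ _)
    exact ((ContinuousLinearMap.proj m).comp ((ContinuousLinearMap.proj p).comp
      (ContinuousLinearMap.proj (R := ℂ) (φ := fun _ : Fin g => Fin n → Fin n → ℂ)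
        (i 0)))).analyticAt a

/-- Composed with a fixed linear map back to matrices, `Γ_L` has a determinant that is a polynomial
in the entries of the tuple; only its analyticity is used. -/
theorem analyticAt_det_comp_mapMPS {g n L : ℕ}
    (l : (⨂[ℂ] _ : Fin L, EuclideanSpace ℂ (Fin g)) →ₗ[ℂ] Matrix (Fin n) (Fin n) ℂ)
    (a : Fin g → Fin n → Fin n → ℂ) :
    AnalyticAt ℂ (fun a : Fin g → Fin n → Fin n → ℂ =>
      LinearMap.det (l ∘ₗ mapMPS L fun i => Matrix.of (a i))) a := by
  let b := Matrix.stdBasis ℂ (Fin n) (Fin n)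
  simp only [← LinearMap.det_toMatrix b, Matrix.det_apply]
  refine Finset.analyticAt_fun_sum _ fun σ _ =>
    AnalyticAt.const_smul (Finset.analyticAt_fun_prod _ fun p _ => ?_)
  simp only [LinearMap.toMatrix_apply, LinearMap.comp_apply, mapMPS, LinearMap.coe_mk,
    AddHom.coe_mk, map_sum, map_smul, Finsupp.coe_finsetSum, Finset.sum_apply, Finsupp.smul_apply,
    smul_eq_mul, Matrix.trace, Matrix.diag, Matrix.mul_apply]
  exact Finset.analyticAt_fun_sum _ fun i _ => AnalyticAt.mul
    (Finset.analyticAt_fun_sum _ fun x _ => Finset.analyticAt_fun_sum _ fun y _ =>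
      analyticAt_const.mul (analyticAt_wordMPS _ _ _ _)) analyticAt_const

/-- The `g`-tuple `(A_1, …, A_g)` is given by its `g * n * n` complex entries, and
`MeasureTheory.volume` is Lebesgue measure on the space of these entries. -/
theorem mainTheorem4 (g n L : ℕ) (hg : 2 ≤ g) (hn : 1 ≤ n)
    (hL : 2 * ⌈Real.logb (g : ℝ) (n : ℝ)⌉ ≤ (L : ℤ)) :
    ∀ᵐ a : Fin g → Fin n → Fin n → ℂ ∂MeasureTheory.volume,
      Function.Injective (mapMPS L fun i => Matrix.of (a i)) := by
  obtain ⟨k, hk, hkL⟩ : ∃ k : ℕ, n ≤ g ^ k ∧ 2 * k ≤ L := by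
    have h1 : (1 : ℝ) < g := by exact_mod_cast hg
    have h2 : (1 : ℝ) ≤ n := by exact_mod_cast hn
    have h3 : 0 ≤ ⌈Real.logb (g : ℝ) (n : ℝ)⌉ := Int.ceil_nonneg (Real.logb_nonneg h1 h2)
    obtain ⟨k, hk⟩ := Int.eq_ofNat_of_zero_le h3
    refine ⟨k, ?_, by omega⟩
    have h4 : Real.logb g n ≤ k := by
      have := Int.le_ceil (Real.logb (g : ℝ) (n : ℝ))
      rwa [hk, Int.cast_natCast] at this
    rw [Real.logb_le_iff_le_rpow h1 (by linarith), Real.rpow_natCast] at h4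
    exact_mod_cast h4
  obtain ⟨ν, j, τ, hν, hτ⟩ := exists_definite_automaton (by omega : 0 < g) hn hk
  have hε : (0 : ℝ) < n + 1 := by positivity
  -- `ε = 1 / (n + 1)` is small enough for diagonal dominance.
  let A : Fin g → Matrix (Fin n) (Fin n) ℂ := transitionMatrix τ j ((n : ℂ) + 1)⁻¹
  have hε' : ‖((n : ℂ) + 1)⁻¹‖ = ((n : ℝ) + 1)⁻¹ := by
    rw [norm_inv]
    exact_mod_cast congrArg _ (Complex.norm_natCast (n + 1))
  have hA : Function.Injective (mapMPS L A) :=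
    injective_mapMPS_of_trace fun X hX =>
      eq_zero_of_trace_mul_transitionMatrix hν hτ hkL
        (inv_ne_zero (by exact_mod_cast n.succ_ne_zero))
        (by rw [hε', Fintype.card_fin, inv_mul_cancel₀ hε.ne']) X hX
  obtain ⟨l, hl⟩ := (mapMPS L A).exists_leftInverse_of_injective (LinearMap.ker_eq_bot.2 hA)
  have han : AnalyticOnNhd ℝ (fun a : Fin g → Fin n → Fin n → ℂ =>
      LinearMap.det (l ∘ₗ mapMPS L fun i => Matrix.of (a i))) Set.univ := fun a _ =>
    (analyticAt_det_comp_mapMPS l a).restrictScalars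
  have _ : (volume : Measure (Fin n → Fin n → ℂ)).IsAddHaarMeasure :=
    isAddHaarMeasure_volume_pi _ _
  have _ : SigmaFinite (volume : Measure (Fin n → Fin n → ℂ)) := sigmaFinite_volume_pi _ _
  have _ : (volume : Measure (Fin g → Fin n → Fin n → ℂ)).IsAddHaarMeasure :=
    isAddHaarMeasure_volume_pi _ _
  filter_upwards [ae_ne_zero_of_analyticOnNhd volume han (a := fun i => A i) (by
    have : (fun i => Matrix.of (A i)) = A := rfl
    simp [this, hl])] with a ha
  have h1 : Function.Injective (l ∘ₗ mapMPS L fun i => Matrix.of (a i)) :=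
    (LinearMap.equivOfDetNeZero _ ha).injective
  exact Function.Injective.of_comp (f := l) h1
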